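/- **Theorem 3.2 (KL canonical form for CSS codes).** A *CSS code* on $n$ qubits is a stabilizer code (a commutative group $S$ of Pauli operators on $n$ qubits with $-1\notin S$; its codespace is the common $+1$ eigenspace of $S$) such that $S$ is generated by operators each of which is either a tensor product of $I$ and $Z$ gates or a tensor product of $I$ and $X$ gates (with sign $+$). A ZX diagram with $k$ inputs and $n$ outputs is in *encoder-respecting form* if it has one ($Z$ or $X$) node per input and per output, each node carrying a phase and exactly one free edge, possibly with a single-qubit (local) operation on it; interior edges are simple, may carry Hadamards, and join two outputs or an input and an output; the outputs are numbered $1,\dots,n$. It *expresses* a code if the linear map $(\mathbb C^2)^{\otimes k}\to(\mathbb C^2)^{\otimes n}$ given by its tensor network is injective with range equal to the codespace. Here a $Z$ node of phase $\alpha$ is the tensor $|0\cdots0\rangle+e^{i\alpha}|1\cdots1\rangle$, and an $X$ node is $|{+}\cdots{+}\rangle+e^{i\alpha}|{-}\cdots{-}\rangle$. For every CSS code on $n$ qubits there are exactly one $k$ and exactly one ZX diagram with $k$ inputs (the inputs being ordered as the rows of the first matrix below) and $n$ outputs, in encoder-respecting form, that expresses the code and satisfies the following rules. - *Bipartite rule:*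 All input nodes are $X$ nodes. Interior edges only join a node of the group consisting of the input nodes and the output $X$ nodes to a node of the group consisting of the output $Z$ nodes. - *Phase-free rule:* All input and output nodes have phase $0$, there are no local operations on any free edges, and there are no Hadamards on interior edges. - *RREF rule:* The adjacency matrix between the input nodes and the output $Z$ nodes (columns ordered by output number) is in reduced row echelon form. The adjacency matrix between the output $X$ nodes and all output nodes (both ordered by output number), where the output $X$ nodes are marked as connected to themselves, is also in reduced row echelon form, the pivot of the row of each output $X$ node being its own column; that is, no output $X$ node is connected to a lower-numbered output $Z$ node. -/

import Mathlib

namespace ZXCSS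

noncomputable section

/-! ### Qubits, Pauli operators and stabilizer codes -/

/-- Computational basis labels of `n` qubits. -/
abbrev Bits (n : ℕ) : Type := Fin n → Fin 2

/-- The state space `(ℂ²)^{⊗ n}`, written in the computational basis. -/
abbrev State (n : ℕ) : Type := Bits n → ℂ

/-- Operators on `n` qubits, as matrices in the computational basis. -/
abbrev Op (n : ℕ) : Type := Matrix (Bits n) (Bits n) ℂ

def pauliX : Matrix (Fin 2) (Fin 2) ℂ := !![0, 1; 1, 0]

def pauliY : Matrix (Fin 2) (Fin 2) ℂ := !![0, -Complex.I; Complex.I, 0]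

def pauliZ : Matrix (Fin 2) (Fin 2) ℂ := !![1, 0; 0, -1]

/-- The Hadamard matrix. -/
def hadamard : Matrix (Fin 2) (Fin 2) ℂ :=
  ((Real.sqrt 2 : ℝ) : ℂ)⁻¹ • !![1, 1; 1, -1]

/-- The tensor product of one single-qubit operator per qubit. -/
def tensor {n : ℕ} (P : Fin n → Matrix (Fin 2) (Fin 2) ℂ) : Op n :=
  Matrix.of fun a b => ∏ i, P i (a i) (b i)

/-- Pauli operators on `n` qubits: `i ^ c` times a tensor product of Pauli matrices. -/
def IsPauli {n : ℕ} (M : Op n) : Prop :=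
  ∃ (c : Fin 4) (P : Fin n → Matrix (Fin 2) (Fin 2) ℂ),
    (∀ i, P i = 1 ∨ P i = pauliX ∨ P i = pauliY ∨ P i = pauliZ) ∧
      M = Complex.I ^ (c : ℕ) • tensor P

/-- Tensor products of `I` and `Z` gates. -/
def IsZType {n : ℕ} (M : Op n) : Prop :=
  ∃ P : Fin n → Matrix (Fin 2) (Fin 2) ℂ, (∀ i, P i = 1 ∨ P i = pauliZ) ∧ M = tensor P

/-- Tensor products of `I` and `X` gates. -/
def IsXType {n : ℕ} (M : Op n) : Prop :=
  ∃ P : Fin n → Matrix (Fin 2) (Fin 2) ℂ, (∀ i, P i = 1 ∨ P i = pauliX) ∧ M = tensor P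

/-- A stabilizer (Clifford) code on `n` physical qubits: a commutative group of Pauli operators
that does not contain `-1`. -/
structure StabilizerCode (n : ℕ) where
  stab : Subgroup (Op n)ˣ
  pauli : ∀ g ∈ stab, IsPauli (g : Op n)
  comm : ∀ g ∈ stab, ∀ h ∈ stab, g * h = h * g
  neg_one_notMem : (-1 : (Op n)ˣ) ∉ stab

/-- The codespace: the intersection of the `+1` eigenspaces of the stabilizers. -/
def StabilizerCode.codespace {n : ℕ} (C : StabilizerCode n) : Submodule ℂ (State n) :=
  ⨅ g ∈ C.stab, Module.End.eigenspace (Matrix.toLin' (g : Op n)) 1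

/-- A CSS code: the stabilizers are generated by operators each of which consists of `I` and `Z`
gates only or of `I` and `X` gates only. -/
def StabilizerCode.IsCSS {n : ℕ} (C : StabilizerCode n) : Prop :=
  ∃ G : Set (Op n)ˣ, Subgroup.closure G = C.stab ∧
    ∀ g ∈ G, IsZType (g : Op n) ∨ IsXType (g : Op n)

/-! ### ZX diagrams in encoder-respecting form -/

/-- The colour of a node: green (`Z`) or red (`X`). -/
inductive Color
  | Z
  | X
  deriving DecidableEq

/-- What joins two nodes: nothing, an ordinary edge, or an edge carrying a Hadamard gate. -/
inductive EdgeKind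
  | none
  | plain
  | hadamard
  deriving DecidableEq

/-- A ZX diagram in encoder-respecting form with `k` inputs and `n` outputs. Its nodes are
`Sum.inl i` (input nodes) and `Sum.inr j` (output nodes, numbered by `Fin n`), and each node has
exactly one free edge. Phases are angles modulo `2π`; `localOp v` is the single-qubit gate on the
free edge of `v`, with value `1` if there is none. Interior edges join two outputs, or an input and
an output. -/
@[ext]
structure Diagram (k n : ℕ) where
  color : Fin k ⊕ Fin n → Color
  phase : Fin k ⊕ Fin n → Real.Angle
  localOp : Fin k ⊕ Fin n → Matrix.unitaryGroup (Fin 2) ℂ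
  edge : Fin k ⊕ Fin n → Fin k ⊕ Fin n → EdgeKind
  edge_symm : ∀ u v, edge u v = edge v u
  edge_self : ∀ v, edge v v = EdgeKind.none
  edge_input : ∀ i i' : Fin k, edge (Sum.inl i) (Sum.inl i') = EdgeKind.none

namespace Diagram

variable {k n : ℕ}

/-- The vectors `|0⟩, |1⟩` for a `Z` node, and `|+⟩, |-⟩` for an `X` node: `legVec c s b` is the
`b`-th coordinate of the `s`-th one. -/
def legVec : Color → Fin 2 → Fin 2 → ℂ
  | Color.Z, s, b => if b = s then 1 else 0
  | Color.X, s, b => hadamard b s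

/-- The matrix sitting on an interior edge. -/
def edgeMatrix : EdgeKind → Matrix (Fin 2) (Fin 2) ℂ
  | EdgeKind.hadamard => hadamard
  | _ => 1

/-- The interior edges, each listed once, with its end points in increasing order (inputs before
outputs). -/
abbrev Edge (D : Diagram k n) : Type :=
  {p : (Fin k ⊕ Fin n) × (Fin k ⊕ Fin n) //
    toLex p.1 < toLex p.2 ∧ D.edge p.1 p.2 ≠ EdgeKind.none}

/-- The tensor of node `v`, i.e. `|0…0⟩ + e^{iα} |1…1⟩` for a `Z` node and `|+…+⟩ + e^{iα} |-…-⟩`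
for an `X` node, evaluated at the index `f` on its free edge and at the indices `y e` on the
(first and second) ends of the interior edges `e` that are attached to `v`. -/
def nodeTensor (D : Diagram k n) (v : Fin k ⊕ Fin n) (f : Fin 2)
    (y : D.Edge → Fin 2 × Fin 2) : ℂ :=
  let leg (s : Fin 2) : ℂ :=
    legVec (D.color v) s f *
      ∏ e : D.Edge,
        (if e.1.1 = v then legVec (D.color v) s (y e).1 else 1) *
          (if e.1.2 = v then legVec (D.color v) s (y e).2 else 1)
  leg 0 + ((D.phase v).toCircle : ℂ) * leg 1

/-- The tensor network of the diagram, contracted over all interior indices, as a matrix from the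
input qubits to the output qubits. -/
def matrix (D : Diagram k n) : Matrix (Bits n) (Bits k) ℂ :=
  Matrix.of fun b a =>
    ∑ f : Fin k ⊕ Fin n → Fin 2, ∑ y : D.Edge → Fin 2 × Fin 2,
      (∏ v, D.nodeTensor v (f v) y) *
      (∏ e : D.Edge, edgeMatrix (D.edge e.1.1 e.1.2) (y e).1 (y e).2) *
      (∏ i : Fin k, (D.localOp (Sum.inl i) : Matrix (Fin 2) (Fin 2) ℂ) (f (Sum.inl i)) (a i)) *
      (∏ j : Fin n, (D.localOp (Sum.inr j) : Matrix (Fin 2) (Fin 2) ℂ) (b j) (f (Sum.inr j)))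

/-- The linear map represented by the diagram (normalization is ignored). -/
def toLin (D : Diagram k n) : State k →ₗ[ℂ] State n := Matrix.toLin' D.matrix

/-- The diagram expresses the code `C`: its linear map is an encoder of `C`, i.e. it is injective
and its range is the codespace. -/
def Expresses (D : Diagram k n) (C : StabilizerCode n) : Prop :=
  Function.Injective D.toLin ∧ LinearMap.range D.toLin = C.codespace

end Diagram

/-! ### Reduced row echelon form -/

section RREF

variable {ι κ F : Type*} [LinearOrder ι] [LinearOrder κ] [Field F]

/-- The leading entry of row `i` is in column `j`. -/
def IsLeading (A : Matrix ι κ F) (i : ι) (j : κ) : Prop :=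
  A i j ≠ 0 ∧ ∀ j' < j, A i j' = 0

/-- Reduced row echelon form. -/
structure IsRREF (A : Matrix ι κ F) : Prop where
  zero_rows : ∀ i i', i < i' → (∀ j, A i j = 0) → ∀ j, A i' j = 0
  stairs : ∀ i i', i < i' → ∀ j j', IsLeading A i j → IsLeading A i' j' → j < j'
  leading_one : ∀ i j, IsLeading A i j → A i j = 1
  leading_only : ∀ i j, IsLeading A i j → ∀ i', i' ≠ i → A i' j = 0

end RREF

/-! ### The rules of the KL form -/

namespace Diagram

variable {k n : ℕ}

/-- Adjacency matrix between the input nodes and the output `Z` nodes. -/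
def inputMatrix (D : Diagram k n) :
    Matrix (Fin k) {j : Fin n // D.color (Sum.inr j) = Color.Z} (ZMod 2) :=
  Matrix.of fun i j => if D.edge (Sum.inl i) (Sum.inr j.1) = EdgeKind.none then 0 else 1

/-- Adjacency matrix between the output `X` nodes and all output nodes, where the output `X` nodes
are marked as connected to themselves. -/
def outputMatrix (D : Diagram k n) :
    Matrix {j : Fin n // D.color (Sum.inr j) = Color.X} (Fin n) (ZMod 2) :=
  Matrix.of fun j l =>
    if j.1 = l then 1
    else if D.edge (Sum.inr j.1) (Sum.inr l) = EdgeKind.none then 0 else 1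

/-- All inputs are `X` nodes, and interior edges only join an (input or output) `X` node and an
output `Z` node. -/
def BipartiteRule (D : Diagram k n) : Prop :=
  (∀ i : Fin k, D.color (Sum.inl i) = Color.X) ∧
    ∀ u v, D.edge u v ≠ EdgeKind.none → D.color u ≠ D.color v

/-- All phases are `0`, there are no local operations on free edges, and there are no Hadamard
gates on interior edges. -/
def PhaseFreeRule (D : Diagram k n) : Prop :=
  (∀ v, D.phase v = 0) ∧ (∀ v, D.localOp v = 1) ∧ ∀ u v, D.edge u v ≠ EdgeKind.hadamard

/-- Both adjacency matrices are in reduced row echelon form, where in the second one the pivot of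
the row of an output `X` node is its own column: no output `X` node is connected to a
lower-numbered output node. -/
def RREFRule (D : Diagram k n) : Prop :=
  IsRREF D.inputMatrix ∧ IsRREF D.outputMatrix ∧ ∀ j, IsLeading D.outputMatrix j j.1

/-- The KL form. -/
def IsKL (D : Diagram k n) : Prop :=
  D.BipartiteRule ∧ D.PhaseFreeRule ∧ D.RREFRule

end Diagram

end

end ZXCSS

/-! A bipartite phase-free diagram is linear algebra over the field with two elements. A `Z` node
copies one bit to all its legs, and an `X` node is a parity check on its legs. Write `A` for the
output matrix and `B` for the adjacency matrix from inputs to all outputs. Contracting the network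
gives, up to a nonzero scalar, the indicator of `A b = 0 ∧ B b = a` (`matrix_apply`), so the diagram
sends `φ` to the function `φ (B b)` on `ker A`, extended by zero.

On the code side, the codespace of a CSS code consists of the functions supported on a subspace `K`
(the solutions of the `Z` checks) and invariant under translation by a subspace `L ≤ K` (spanned by
the `X` generators); the inclusion is the commutation of the two types (`exists_subspaces`). A KL
diagram therefore expresses the code as soon as `ker A = K`, `ker A ∩ ker B = L` and `B` maps `ker
A` onto all input labels.

What remains is uniqueness of reduced echelon matrices with a given kernel (`range_eq`, `row_eq`)
and their existence (`exists_isReduced_ker`). The pivots of `A` are the output `X` nodes, so `K`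
fixes the colours and `A`. The `Z` coordinates parametrize `K`, and `B` involves only these, so its
kernel is fixed by the projection of `L` to them. Injectivity excludes zero rows of `B`, and `2 ^ k`
is the dimension of the codespace. -/

namespace ZXCSS

/-! ### Bits and signs over the field with two elements -/

noncomputable section

/-- A qubit label as an element of the field with two elements. -/
def bit : Fin 2 ≃ ZMod 2 := Equiv.refl _

/-- Basis labels as vectors over the field with two elements. -/
def bits {n : ℕ} : Bits n ≃ (Fin n → ZMod 2) := Equiv.arrowCongr (Equiv.refl _) bit

lemma bits_apply {n : ℕ} (b : Bits n) (i : Fin n) : bits b i = bit (b i) := rfl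

lemma bit_zero : bit 0 = 0 := rfl

lemma bit_one : bit 1 = 1 := rfl

/-- The nontrivial additive character of `ZMod 2`. -/
def bitSign (b : ZMod 2) : ℂ := if b = 0 then 1 else -1

lemma bitSign_zero : bitSign 0 = 1 := if_pos rfl

lemma bitSign_one : bitSign 1 = -1 := if_neg one_ne_zero

lemma zmod_two_cases (a : ZMod 2) : a = 0 ∨ a = 1 := by
  fin_cases a
  · exact Or.inl rfl
  · exact Or.inr rfl

lemma bitSign_add (a b : ZMod 2) : bitSign (a + b) = bitSign a * bitSign b := by
  have h : (1 + 1 : ZMod 2) = 0 := rfl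
  rcases zmod_two_cases a with rfl | rfl <;> rcases zmod_two_cases b with rfl | rfl <;>
    simp [h, bitSign_zero, bitSign_one]

lemma bitSign_sum {ι : Type*} (s : Finset ι) (g : ι → ZMod 2) :
    bitSign (∑ i ∈ s, g i) = ∏ i ∈ s, bitSign (g i) := by
  classical
  induction s using Finset.induction_on with
  | empty => simp [bitSign]
  | insert a s ha ih => rw [Finset.sum_insert ha, Finset.prod_insert ha, bitSign_add, ih]

lemma one_add_bitSign (a : ZMod 2) : 1 + bitSign a = if a = 0 then 2 else 0 := by
  unfold bitSign
  split_ifs <;> norm_num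

lemma hadamard_apply_zero (b : Fin 2) : hadamard b 0 = ((Real.sqrt 2 : ℝ) : ℂ)⁻¹ := by
  fin_cases b <;> simp [hadamard]

lemma hadamard_apply_one (b : Fin 2) :
    hadamard b 1 = ((Real.sqrt 2 : ℝ) : ℂ)⁻¹ * bitSign (bit b) := by
  fin_cases b <;> simp [hadamard, bit_zero, bit_one, bitSign_zero, bitSign_one]

/-! ### Contraction of a bipartite phase-free tensor network -/

namespace Diagram

variable {k n : ℕ}

/-- The `0/1` adjacency between nodes. -/
def adj (D : Diagram k n) (u v : Fin k ⊕ Fin n) : ZMod 2 :=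
  if D.edge u v = EdgeKind.none then 0 else 1

/-- Adjacency matrix between the input nodes and all output nodes. -/
def fullInputMatrix (D : Diagram k n) : Matrix (Fin k) (Fin n) (ZMod 2) :=
  Matrix.of fun i j => D.adj (Sum.inl i) (Sum.inr j)

/-- Summing over the edges at a node is summing over its neighbours. -/
lemma sum_edge_eq (D : Diagram k n) (v : Fin k ⊕ Fin n) (g : Fin k ⊕ Fin n → ZMod 2) :
    ∑ e : D.Edge, ((if e.1.1 = v then g e.1.2 else 0) + (if e.1.2 = v then g e.1.1 else 0)) =
      ∑ u, D.adj v u * g u := by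
  classical
  have h := Finset.sum_subtype_of_mem (p := fun p : (Fin k ⊕ Fin n) × (Fin k ⊕ Fin n) =>
      toLex p.1 < toLex p.2 ∧ D.edge p.1 p.2 ≠ EdgeKind.none)
    (s := Finset.univ.filter fun p : (Fin k ⊕ Fin n) × (Fin k ⊕ Fin n) =>
      toLex p.1 < toLex p.2 ∧ D.edge p.1 p.2 ≠ EdgeKind.none)
    (fun p => (if p.1 = v then g p.2 else 0) + (if p.2 = v then g p.1 else 0)) (by simp)
  have h2 : (Finset.univ.filter fun p : (Fin k ⊕ Fin n) × (Fin k ⊕ Fin n) =>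
      toLex p.1 < toLex p.2 ∧ D.edge p.1 p.2 ≠ EdgeKind.none).subtype (fun p =>
      toLex p.1 < toLex p.2 ∧ D.edge p.1 p.2 ≠ EdgeKind.none) = Finset.univ := by
    ext x
    simpa using x.2
  rw [h2] at h
  refine (Finset.sum_congr (by ext; simp) fun _ _ => rfl).trans (h.trans ?_)
  rw [Finset.sum_filter]
  -- An edge at `v` is listed with `v` either first or second. The two terms collect the neighbours
  -- of `v` that come after and before it, so each neighbour is counted once.
  have h3 : ∀ p : (Fin k ⊕ Fin n) × (Fin k ⊕ Fin n),
      (if toLex p.1 < toLex p.2 ∧ D.edge p.1 p.2 ≠ EdgeKind.none then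
        (if p.1 = v then g p.2 else 0) + (if p.2 = v then g p.1 else 0) else 0) =
      (if p.1 = v then (if toLex v < toLex p.2 then D.adj v p.2 * g p.2 else 0) else 0) +
      (if p.2 = v then (if toLex p.1 < toLex v then D.adj v p.1 * g p.1 else 0) else 0) := by
    rintro ⟨p, q⟩
    dsimp only
    by_cases h1 : p = v
    · subst h1
      by_cases h2 : q = p
      · subst h2
        simp
      · by_cases h3 : toLex p < toLex q <;> by_cases h4 : D.edge p q = EdgeKind.none <;>
          simp [h2, h3, h4, adj]
    · by_cases h2 : q = v
      · subst h2
        rw [show D.adj q p = D.adj p q from by rw [adj, adj, D.edge_symm q p]]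
        by_cases h3 : toLex p < toLex q <;> by_cases h4 : D.edge p q = EdgeKind.none <;>
          simp [h1, h3, h4, adj]
      · simp [h1, h2]
  rw [Finset.sum_congr rfl fun p _ => h3 p, Finset.sum_add_distrib, Fintype.sum_prod_type,
    Fintype.sum_prod_type_right]
  simp only [Finset.sum_ite_irrel, Finset.sum_const_zero, Finset.sum_ite_eq', Finset.mem_univ,
    if_true]
  rw [← Finset.sum_add_distrib]
  refine Finset.sum_congr rfl fun u _ => ?_
  rcases lt_trichotomy (toLex v) (toLex u) with h | h | h
  · simp [h, h.not_gt]
  · obtain rfl : v = u := h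
    simp [adj, D.edge_self]
  · simp [h, h.not_gt]

variable {D : Diagram k n}

/-- The coordinates of `|+…+⟩` and `|-…-⟩` differ only by the sign `(-1)^parity`, so their sum is a
common factor times `1 + (-1)^parity`: a parity check. The scalar `c` is `2` times one factor `1/√2`
per leg. -/
lemma nodeTensor_X {v : Fin k ⊕ Fin n} (hv : D.color v = Color.X) (hp : D.phase v = 0) :
    ∃ c : ℂ, c ≠ 0 ∧ ∀ (f : Fin 2) (y : D.Edge → Fin 2 × Fin 2),
      D.nodeTensor v f y =
        if bit f + ∑ e : D.Edge, ((if e.1.1 = v then bit (y e).1 else 0) +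
          (if e.1.2 = v then bit (y e).2 else 0)) = 0 then c else 0 := by
  set r : ℂ := ((Real.sqrt 2 : ℝ) : ℂ)⁻¹ with hr
  have hr0 : r ≠ 0 := by simp [hr]
  refine ⟨(r * ∏ e : D.Edge, (if e.1.1 = v then r else 1) * (if e.1.2 = v then r else 1)) * 2,
    ?_, fun f y => ?_⟩
  · refine mul_ne_zero (mul_ne_zero hr0 (Finset.prod_ne_zero_iff.2 fun e _ => ?_)) two_ne_zero
    split_ifs <;> simp [hr0]
  · have key : ∀ e : D.Edge,
        (if e.1.1 = v then legVec Color.X 1 (y e).1 else 1) *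
          (if e.1.2 = v then legVec Color.X 1 (y e).2 else 1) =
        ((if e.1.1 = v then r else 1) * (if e.1.2 = v then r else 1)) *
          bitSign ((if e.1.1 = v then bit (y e).1 else 0) + (if e.1.2 = v then bit (y e).2 else 0)) := by
      intro e
      rw [bitSign_add]
      split_ifs <;> simp only [legVec, hadamard_apply_one, bitSign_zero, ← hr] <;> ring
    have h1 : D.nodeTensor v f y =
        (r * ∏ e : D.Edge, (if e.1.1 = v then r else 1) * (if e.1.2 = v then r else 1)) *
        (1 + bitSign (bit f + ∑ e : D.Edge, ((if e.1.1 = v then bit (y e).1 else 0) +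
          (if e.1.2 = v then bit (y e).2 else 0)))) := by
      unfold nodeTensor
      simp only [hv, hp, key]
      rw [Finset.prod_mul_distrib (f := fun e : D.Edge =>
        (if e.1.1 = v then r else 1) * (if e.1.2 = v then r else 1)), ← bitSign_sum, bitSign_add]
      simp only [legVec, hadamard_apply_zero, hadamard_apply_one, ← hr,
        Real.Angle.toCircle_zero, Circle.coe_one]
      ring
    rw [h1, one_add_bitSign]
    split_ifs <;> simp

lemma nodeTensor_Z_eq_one {v : Fin k ⊕ Fin n} (hv : D.color v = Color.Z) (hp : D.phase v = 0)
    {f : Fin 2} {y : D.Edge → Fin 2 × Fin 2} (h1 : ∀ e : D.Edge, e.1.1 = v → (y e).1 = f)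
    (h2 : ∀ e : D.Edge, e.1.2 = v → (y e).2 = f) : D.nodeTensor v f y = 1 := by
  have h : ∀ s : Fin 2, legVec Color.Z s f * ∏ e : D.Edge,
        (if e.1.1 = v then legVec Color.Z s (y e).1 else 1) *
          (if e.1.2 = v then legVec Color.Z s (y e).2 else 1) = if f = s then 1 else 0 := by
    intro s
    by_cases hs : f = s
    · subst hs
      simp only [legVec, if_true, one_mul]
      refine Finset.prod_eq_one fun e _ => ?_
      have h1 := h1 e
      have h2 := h2 e
      split_ifs <;> simp_all
    · simp [legVec, hs]
  unfold nodeTensor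
  simp only [hv, hp, h, Real.Angle.toCircle_zero, Circle.coe_one]
  fin_cases f <;> simp

lemma nodeTensor_Z_eq_zero {v : Fin k ⊕ Fin n} (hv : D.color v = Color.Z)
    {f : Fin 2} {y : D.Edge → Fin 2 × Fin 2} (e : D.Edge)
    (he : (e.1.1 = v ∧ (y e).1 ≠ f) ∨ (e.1.2 = v ∧ (y e).2 ≠ f)) : D.nodeTensor v f y = 0 := by
  have h : ∀ s : Fin 2, legVec Color.Z s f * ∏ e : D.Edge,
        (if e.1.1 = v then legVec Color.Z s (y e).1 else 1) *
          (if e.1.2 = v then legVec Color.Z s (y e).2 else 1) = 0 := by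
    intro s
    by_cases hs : f = s
    · subst hs
      rw [Finset.prod_eq_zero (Finset.mem_univ e), mul_zero]
      rcases he with ⟨h1, h2⟩ | ⟨h1, h2⟩ <;> simp [h1, h2, legVec]
    · simp [legVec, hs]
  unfold nodeTensor
  simp only [hv, h]
  simp

/-- The values on the interior edges that are forced by the values on the free edges. -/
def edgeValue (D : Diagram k n) (f : Fin k ⊕ Fin n → Fin 2) (e : D.Edge) : Fin 2 × Fin 2 :=
  if D.color e.1.1 = Color.Z then (f e.1.1, f e.1.1) else (f e.1.2, f e.1.2)

lemma color_cases (c : Color) : c = Color.Z ∨ c = Color.X := by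
  cases c <;> simp

lemma BipartiteRule.edge_color (hB : D.BipartiteRule) (e : D.Edge) :
    (D.color e.1.1 = Color.Z ∧ D.color e.1.2 = Color.X) ∨
      (D.color e.1.1 = Color.X ∧ D.color e.1.2 = Color.Z) := by
  have h := hB.2 _ _ e.2.2
  rcases color_cases (D.color e.1.1) with h1 | h1 <;>
    rcases color_cases (D.color e.1.2) with h2 | h2 <;> simp_all

/-- Once each edge carries the bit of its `Z` end, a `Z` node imposes no condition, while the legs
of an `X` node read the free bits of its neighbours. -/
lemma nodeTensor_edgeValue (hB : D.BipartiteRule) (hP : D.PhaseFreeRule) (v : Fin k ⊕ Fin n) :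
    ∃ c : ℂ, c ≠ 0 ∧ ∀ f : Fin k ⊕ Fin n → Fin 2, D.nodeTensor v (f v) (D.edgeValue f) =
      if D.color v = Color.X → bit (f v) + ∑ u, D.adj v u * bit (f u) = 0 then c else 0 := by
  rcases color_cases (D.color v) with hv | hv
  · refine ⟨1, one_ne_zero, fun f => ?_⟩
    rw [if_pos (by simp [hv])]
    refine nodeTensor_Z_eq_one hv (hP.1 v) (fun e he => ?_) fun e he => ?_
    · rw [edgeValue, if_pos (by rw [he, hv]), he]
    · rcases hB.edge_color e with ⟨-, h2⟩ | ⟨h1, -⟩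
      · rw [he, hv] at h2
        cases h2
      · rw [edgeValue, if_neg (by simp [h1]), he]
  · obtain ⟨c, hc, h⟩ := nodeTensor_X hv (hP.1 v)
    refine ⟨c, hc, fun f => ?_⟩
    rw [h, ← sum_edge_eq]
    simp only [hv, true_imp_iff]
    have : ∀ e : D.Edge, ((if e.1.1 = v then bit (D.edgeValue f e).1 else 0) +
        (if e.1.2 = v then bit (D.edgeValue f e).2 else 0)) =
        ((if e.1.1 = v then bit (f e.1.2) else 0) + (if e.1.2 = v then bit (f e.1.1) else 0)) := by
      intro e
      rcases hB.edge_color e with ⟨h1, h2⟩ | ⟨h1, h2⟩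
      · have : e.1.1 ≠ v := by
          rintro he
          rw [he, hv] at h1
          cases h1
        simp [edgeValue, h1, this]
      · have : e.1.2 ≠ v := by
          rintro he
          rw [he, hv] at h2
          cases h2
        simp [edgeValue, h1, this]
    rw [Finset.sum_congr rfl fun e _ => this e]

/-- Only one term of the contraction survives. The trivial local operations identify the free
indices with `a` and `b`; each interior edge has exactly one `Z` end, which copies its free bit onto
the edge. -/
lemma matrix_eq_prod (hB : D.BipartiteRule) (hP : D.PhaseFreeRule) (b : Bits n) (a : Bits k) :
    D.matrix b a =
      ∏ v, D.nodeTensor v ((Sum.elim a b : _ → Fin 2) v) (D.edgeValue (Sum.elim a b)) := by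
  have hedge : ∀ u v, edgeMatrix (D.edge u v) = 1 := by
    intro u v
    unfold edgeMatrix
    split
    · exact absurd ‹_› (hP.2.2 u v)
    · rfl
  simp only [matrix, Matrix.of_apply, hP.2.1, hedge]
  rw [Finset.sum_eq_single (Sum.elim a b : Fin k ⊕ Fin n → Fin 2),
    Finset.sum_eq_single (D.edgeValue (Sum.elim a b))]
  · have h1 : ∏ e : D.Edge, (1 : Matrix (Fin 2) (Fin 2) ℂ) (D.edgeValue (Sum.elim a b) e).1
        (D.edgeValue (Sum.elim a b) e).2 = 1 := by
      refine Finset.prod_eq_one fun e _ => ?_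
      have : (D.edgeValue (Sum.elim a b) e).1 = (D.edgeValue (Sum.elim a b) e).2 := by
        unfold edgeValue
        split_ifs <;> rfl
      rw [this, Matrix.one_apply_eq]
    rw [h1]
    simp
  · intro y _ hy
    obtain ⟨e, he⟩ := Function.ne_iff.1 hy
    -- If the two ends differ, the identity matrix on the edge gives zero; if they agree, the value
    -- contradicts the bit of the `Z` end, and that node gives zero.
    by_cases h12 : (y e).1 = (y e).2
    · refine mul_eq_zero_of_left (mul_eq_zero_of_left (mul_eq_zero_of_left ?_ _) _) _
      rcases hB.edge_color e with ⟨h1, -⟩ | ⟨h1, h2⟩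
      · refine Finset.prod_eq_zero (Finset.mem_univ e.1.1)
          (nodeTensor_Z_eq_zero h1 e (Or.inl ⟨rfl, fun h => he ?_⟩))
        rw [edgeValue, if_pos h1]
        exact Prod.ext h (h12.symm.trans h)
      · refine Finset.prod_eq_zero (Finset.mem_univ e.1.2)
          (nodeTensor_Z_eq_zero h2 e (Or.inr ⟨rfl, fun h => he ?_⟩))
        rw [edgeValue, if_neg (by simp [h1])]
        exact Prod.ext (h12.trans h) h
    · refine mul_eq_zero_of_left (mul_eq_zero_of_left (mul_eq_zero_of_right _ ?_) _) _
      exact Finset.prod_eq_zero (Finset.mem_univ e) (Matrix.one_apply_ne h12)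
  · simp
  · intro f _ hf
    refine Finset.sum_eq_zero fun y _ => ?_
    obtain ⟨v, hv⟩ := Function.ne_iff.1 hf
    rcases v with i | j
    · refine mul_eq_zero_of_left (mul_eq_zero_of_right _ ?_) _
      exact Finset.prod_eq_zero (Finset.mem_univ i) (Matrix.one_apply_ne hv)
    · refine mul_eq_zero_of_right _ ?_
      exact Finset.prod_eq_zero (Finset.mem_univ j) (Matrix.one_apply_ne (Ne.symm hv))
  · simp

lemma adj_eq_zero_of_color (hB : D.BipartiteRule) {u v : Fin k ⊕ Fin n}
    (h : D.color u = D.color v) : D.adj u v = 0 := by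
  by_contra h'
  exact hB.2 u v (fun he => h' (by simp [adj, he])) h

/-- A bipartite phase-free diagram is, up to a scalar, the linear relation given by its adjacency
matrices. -/
theorem matrix_apply (hB : D.BipartiteRule) (hP : D.PhaseFreeRule) :
    ∃ c : ℂ, c ≠ 0 ∧ ∀ (b : Bits n) (a : Bits k), D.matrix b a =
      if D.outputMatrix.mulVec (bits b) = 0 ∧ D.fullInputMatrix.mulVec (bits b) = bits a
      then c else 0 := by
  classical
  choose c hc h using nodeTensor_edgeValue hB hP
  refine ⟨∏ v, c v, Finset.prod_ne_zero_iff.2 fun v _ => hc v, fun b a => ?_⟩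
  simp only [matrix_eq_prod hB hP, h]
  have hcond : (D.outputMatrix.mulVec (bits b) = 0 ∧ D.fullInputMatrix.mulVec (bits b) = bits a) ↔
      ∀ v, D.color v = Color.X → bit ((Sum.elim a b : _ → Fin 2) v) +
        ∑ u, D.adj v u * bit ((Sum.elim a b : _ → Fin 2) u) = 0 := by
    rw [Sum.forall, and_comm]
    refine and_congr ?_ ?_
    · rw [funext_iff]
      refine forall_congr' fun i => ?_
      have h0 : ∀ i', D.adj (Sum.inl i) (Sum.inl i') = 0 := fun i' => by
        simp [adj, D.edge_input]
      simp only [hB.1 i, true_imp_iff, Fintype.sum_sum_type, h0, Sum.elim_inl, Sum.elim_inr,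
        zero_mul, Finset.sum_const_zero, zero_add, Matrix.mulVec, dotProduct, fullInputMatrix,
        Matrix.of_apply, bits_apply]
      rw [← CharTwo.sub_eq_add, sub_eq_zero, eq_comm]
    · rw [funext_iff, Subtype.forall]
      refine forall_congr' fun j => forall_congr' fun hj => ?_
      have h0 : ∀ i', D.adj (Sum.inr j) (Sum.inl i') = 0 := fun i' =>
        adj_eq_zero_of_color hB (hj.trans (hB.1 i').symm)
      simp only [Fintype.sum_sum_type, h0, Sum.elim_inl, Sum.elim_inr,
        zero_mul, Finset.sum_const_zero, zero_add, Matrix.mulVec, dotProduct, outputMatrix,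
        Matrix.of_apply, bits_apply, Pi.zero_apply]
      have : ∀ l : Fin n, (if j = l then 1 else
          if D.edge (Sum.inr j) (Sum.inr l) = EdgeKind.none then 0 else 1 : ZMod 2) * bit (b l) =
          (if j = l then bit (b l) else 0) + D.adj (Sum.inr j) (Sum.inr l) * bit (b l) := by
        intro l
        split_ifs with h1 h2
        · subst h1
          simp [adj, D.edge_self]
        · simp [adj, h2]
        · simp [adj, h2]
      rw [Finset.sum_congr rfl fun l _ => this l, Finset.sum_add_distrib]
      simp
  simp only [hcond]
  split_ifs with hall
  · exact Finset.prod_congr rfl fun v _ => if_pos (hall v)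
  · obtain ⟨v, hv⟩ := not_forall.1 hall
    exact Finset.prod_eq_zero (Finset.mem_univ v) (if_neg hv)

end Diagram

end

end ZXCSS

/-! ### Reduced matrices and their kernels -/

namespace ZXCSS

noncomputable section

section Reduced

variable {ι ι' κ F : Type*} [LinearOrder κ] [Field F]

/-- `A` is a matrix whose rows have their leading ones in the columns `p`, and whose pivot columns
have no other entries. -/
structure IsReduced (A : Matrix ι κ F) (p : ι → κ) : Prop where
  pivot : ∀ i, A i (p i) = 1
  pivot_only : ∀ i i', i' ≠ i → A i' (p i) = 0
  before : ∀ i, ∀ j < p i, A i j = 0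

namespace IsReduced

variable {A : Matrix ι κ F} {p : ι → κ} {B : Matrix ι' κ F} {q : ι' → κ}

lemma isLeading (h : IsReduced A p) (i : ι) : IsLeading A i (p i) :=
  ⟨by simp [h.pivot i], h.before i⟩

lemma injective (h : IsReduced A p) : Function.Injective p := by
  intro i i' hii
  by_contra hne
  have := h.pivot_only i i' (Ne.symm hne)
  rw [hii, h.pivot i'] at this
  exact one_ne_zero this

lemma eq_of_isLeading (h : IsReduced A p) {i : ι} {j : κ} (hj : IsLeading A i j) : j = p i := by
  rcases lt_trichotomy j (p i) with hlt | rfl | hlt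
  · exact absurd (h.before i j hlt) hj.1
  · rfl
  · exact absurd (hj.2 _ hlt) (h.isLeading i).1

lemma isRREF [LinearOrder ι] (h : IsReduced A p) (hp : StrictMono p) : IsRREF A where
  zero_rows i i' _ h0 := absurd (h0 (p i)) (by simp [h.pivot i])
  stairs i i' hii j j' hj hj' := by
    rw [h.eq_of_isLeading hj, h.eq_of_isLeading hj']
    exact hp hii
  leading_one i j hj := by
    rw [h.eq_of_isLeading hj]
    exact h.pivot i
  leading_only i j hj i' hne := by
    rw [h.eq_of_isLeading hj]
    exact h.pivot_only i i' hne

variable [Fintype κ]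

/-- The kernel vector with free coordinate `j`. -/
lemma exists_ker (h : IsReduced A p) {j : κ} (hj : j ∉ Set.range p) :
    ∃ v : κ → F, A.mulVec v = 0 ∧ v j = 1 ∧ (∀ l, l ∉ Set.range p → l ≠ j → v l = 0) ∧
      (∀ i, v (p i) = - A i j) ∧ ∀ l, j < l → v l = 0 := by
  classical
  let v : κ → F := fun l => if hl : ∃ i, p i = l then - A hl.choose j else if l = j then 1 else 0
  have hv : ∀ i, v (p i) = - A i j := by
    intro i
    have hl : ∃ i', p i' = p i := ⟨i, rfl⟩
    have : hl.choose = i := h.injective hl.choose_spec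
    simp only [v, dif_pos hl, this]
  have hvn : ∀ l, l ∉ Set.range p → v l = if l = j then 1 else 0 := fun l hl => dif_neg hl
  refine ⟨v, ?_, by simp [hvn j hj], fun l hl hlj => by simp [hvn l hl, hlj], hv, ?_⟩
  · ext i
    have hne : j ≠ p i := fun e => hj ⟨i, e.symm⟩
    have : ∀ l, A i l * v l = (if l = p i then - A i j else 0) + (if l = j then A i j else 0) := by
      intro l
      by_cases hl : l ∈ Set.range p
      · obtain ⟨i', rfl⟩ := hl
        have h1 : p i' ≠ j := fun e => hj ⟨i', e⟩
        rw [hv, if_neg h1]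
        by_cases h2 : i' = i
        · subst h2; simp [h.pivot]
        · rw [h.pivot_only i' i (Ne.symm h2), if_neg (fun e => h2 (h.injective e))]; simp
      · rw [hvn l hl, if_neg (c := l = p i) (fun e => hl ⟨i, e.symm⟩)]
        split_ifs with h3
        · subst h3; simp
        · simp
    simp [Matrix.mulVec, dotProduct, this, Finset.sum_add_distrib]
  · intro l hl
    by_cases hlr : l ∈ Set.range p
    · obtain ⟨i, rfl⟩ := hlr
      rw [hv, h.before i j hl, neg_zero]
    · rw [hvn l hlr, if_neg hl.ne']

open scoped Classical in
/-- A vector of the kernel is determined by its free coordinates. -/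
lemma apply_pivot (h : IsReduced A p) {v : κ → F} (hv : A.mulVec v = 0) (i : ι) :
    v (p i) = - ∑ l, if l ∈ Set.range p then 0 else A i l * v l := by
  have h1 := congrFun hv i
  simp only [Matrix.mulVec, dotProduct, Pi.zero_apply] at h1
  have : ∀ l, A i l * v l = (if l = p i then v (p i) else 0) +
      (if l ∈ Set.range p then 0 else A i l * v l) := by
    intro l
    by_cases hl : l ∈ Set.range p
    · obtain ⟨i', rfl⟩ := hl
      by_cases h2 : i' = i
      · subst h2; simp [h.pivot]
      · rw [h.pivot_only i' i (Ne.symm h2), if_neg (fun e => h2 (h.injective e))]; simp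
    · rw [if_neg (fun e => hl ⟨i, e.symm⟩)]; simp [hl]
  rw [Finset.sum_congr rfl fun l _ => this l, Finset.sum_add_distrib] at h1
  simp only [Finset.sum_ite_eq', Finset.mem_univ, if_true] at h1
  exact eq_neg_of_add_eq_zero_left h1

lemma ker_ext (h : IsReduced A p) {v w : κ → F} (hv : A.mulVec v = 0) (hw : A.mulVec w = 0)
    (hvw : ∀ l, l ∉ Set.range p → v l = w l) : v = w := by
  ext l
  by_cases hl : l ∈ Set.range p
  · obtain ⟨i, rfl⟩ := hl
    rw [h.apply_pivot hv, h.apply_pivot hw]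
    congr 1
    refine Finset.sum_congr rfl fun l _ => ?_
    split_ifs with h1
    · rfl
    · rw [hvw l h1]
  · exact hvw l hl

/-- The free coordinates of a kernel vector are arbitrary. -/
lemma exists_ker_extend (h : IsReduced A p) (w : κ → F) :
    ∃ v : κ → F, A.mulVec v = 0 ∧ ∀ l, l ∉ Set.range p → v l = w l := by
  classical
  choose u hu using fun j : {j : κ // j ∉ Set.range p} => h.exists_ker j.2
  refine ⟨∑ j, w j.1 • u j, ?_, fun l hl => ?_⟩
  · rw [Matrix.mulVec_sum]
    simp [Matrix.mulVec_smul, (hu _).1]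
  · rw [Finset.sum_apply, Finset.sum_eq_single ⟨l, hl⟩]
    · simp [(hu ⟨l, hl⟩).2.1]
    · intro j _ hj
      have := (hu j).2.2.1 l hl (fun e => hj (Subtype.ext e.symm))
      simp [this]
    · simp

lemma mulVec_surjective [Fintype ι] (h : IsReduced A p) (a : ι → F) :
    ∃ w : κ → F, A.mulVec w = a := by
  classical
  refine ⟨∑ i, a i • Pi.single (p i) 1, ?_⟩
  rw [Matrix.mulVec_sum]
  ext i
  simp only [Matrix.mulVec_smul, Finset.sum_apply, Pi.smul_apply, Matrix.mulVec_single_one,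
    smul_eq_mul, Matrix.col_apply]
  rw [Finset.sum_eq_single i]
  · simp [h.pivot]
  · intro i' _ hi
    simp [h.pivot_only i' i hi.symm]
  · simp

/-- If `j` were the pivot of a row, that row would vanish before `j` and `v` after it, so the row
applied to `v` would be `v j ≠ 0`. -/
lemma pivot_of_ker (h : IsReduced A p) {v : κ → F} (hv : A.mulVec v = 0) {j : κ}
    (hj : v j ≠ 0) (hlast : ∀ l, j < l → v l = 0) : j ∉ Set.range p := by
  rintro ⟨i, rfl⟩
  have h1 := congrFun hv i
  rw [Matrix.mulVec, dotProduct, Finset.sum_eq_single (p i)] at h1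
  · simp [h.pivot, hj] at h1
  · intro l _ hl
    rcases lt_or_gt_of_ne hl with h2 | h2
    · simp [h.before i l h2]
    · simp [hlast l h2]
  · simp

/-- The non-pivots are exactly the positions of last nonzero entries of kernel vectors, so a larger
kernel has fewer pivots. -/
lemma range_subset (hA : IsReduced A p) (hB : IsReduced B q)
    (hker : ∀ v, A.mulVec v = 0 → B.mulVec v = 0) : Set.range q ⊆ Set.range p := by
  intro j hj
  by_contra hjp
  obtain ⟨v, hv, hvj, -, -, hlast⟩ := hA.exists_ker hjp
  exact hB.pivot_of_ker (hker v hv) (by simp [hvj]) hlast hj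

/-- The kernel determines the pivots. -/
lemma range_eq (hA : IsReduced A p) (hB : IsReduced B q)
    (hker : ∀ v, A.mulVec v = 0 ↔ B.mulVec v = 0) : Set.range p = Set.range q :=
  (hB.range_subset hA fun v => (hker v).2).antisymm (hA.range_subset hB fun v => (hker v).1)

/-- The kernel determines the rows. -/
lemma row_eq (hA : IsReduced A p) (hB : IsReduced B q)
    (hker : ∀ v, A.mulVec v = 0 ↔ B.mulVec v = 0) {i : ι} {i' : ι'} (hi : p i = q i') (j : κ) :
    A i j = B i' j := by
  have hr := hA.range_eq hB hker
  by_cases hj : j ∈ Set.range p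
  · obtain ⟨l, rfl⟩ := hj
    by_cases hl : l = i
    · subst hl
      rw [hA.pivot, hi, hB.pivot]
    · rw [hA.pivot_only l i (Ne.symm hl)]
      obtain ⟨l', hl'⟩ : p l ∈ Set.range q := hr ▸ ⟨l, rfl⟩
      rw [← hl', hB.pivot_only l' i']
      rintro rfl
      exact hl (hA.injective (hl'.symm.trans hi.symm))
  -- A free column is, up to sign, the list of pivot entries of the kernel vector with free
  -- coordinate `j`. These vectors for `A` and `B` agree on the free coordinates, hence coincide.
  · obtain ⟨v, hv, hvj, hv0, hvp, -⟩ := hA.exists_ker hj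
    obtain ⟨w, hw, hwj, hw0, hwp, -⟩ := hB.exists_ker (hr ▸ hj)
    have : v = w := by
      refine hA.ker_ext hv ((hker w).2 hw) fun l hl => ?_
      by_cases hlj : l = j
      · subst hlj
        rw [hvj, hwj]
      · rw [hv0 l hl hlj, hw0 l (hr ▸ hl) hlj]
    have h1 := hvp i
    rw [this, hi, hwp] at h1
    exact (neg_inj.1 h1).symm

end IsReduced

lemma IsRREF.isReduced [LinearOrder ι] {A : Matrix ι κ F} {p : ι → κ} (h : IsRREF A)
    (hp : ∀ i, IsLeading A i (p i)) : IsReduced A p where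
  pivot i := h.leading_one i _ (hp i)
  pivot_only i i' hne := h.leading_only i _ (hp i) i' hne
  before i j hj := (hp i).2 j hj

lemma IsRREF.strictMono [LinearOrder ι] {A : Matrix ι κ F} {p : ι → κ} (h : IsRREF A)
    (hp : ∀ i, IsLeading A i (p i)) : StrictMono p :=
  fun i i' hii => h.stairs i i' hii _ _ (hp i) (hp i')

lemma exists_isLeading [Finite κ] {A : Matrix ι κ F} {i : ι} (h : ∃ j, A i j ≠ 0) :
    ∃ j, IsLeading A i j := by
  obtain ⟨j, hj, hmin⟩ := WellFounded.has_min (wellFounded_lt (α := κ)) {j | A i j ≠ 0} h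
  exact ⟨j, hj, fun j' hj' => by_contra fun h' => hmin j' h' hj'⟩

/-- Every subspace is the kernel of a reduced matrix. -/
theorem exists_isReduced_ker [Fintype κ] (K : Submodule F (κ → F)) :
    ∃ (P : Set κ) (A : Matrix P κ F), IsReduced A (Subtype.val : P → κ) ∧
      ∀ v, A.mulVec v = 0 ↔ v ∈ K := by
  classical
  -- The pivots must be the positions that are never the last nonzero entry of a vector of `K`.
  let P : Set κ := {j | ∀ v ∈ K, (∀ l, j < l → v l = 0) → v j = 0}
  have hdet : ∀ v ∈ K, (∀ l, l ∉ P → v l = 0) → v = 0 := by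
    intro v hv h0
    by_contra hne
    obtain ⟨j, hj, hmax⟩ := WellFounded.has_min (wellFounded_gt (α := κ)) {j | v j ≠ 0}
      (Function.ne_iff.1 hne)
    refine hj ?_
    by_cases hjP : j ∈ P
    · exact hjP v hv fun l hl => by_contra fun h => hmax l h hl
    · exact h0 j hjP
  -- A reduced basis of `K`, built by induction on `j`: a vector ending at `j` is cleared at the
  -- earlier free positions by the earlier basis vectors, then normalized.
  have hex : ∀ j, j ∉ P → ∃ v ∈ K, v j = 1 ∧ (∀ l, j < l → v l = 0) ∧
      ∀ l, l ∉ P → l ≠ j → v l = 0 := by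
    intro j
    induction j using WellFoundedLT.induction with
    | ind j ih =>
      intro hj
      simp only [P, Set.mem_ofPred_eq, not_forall] at hj
      obtain ⟨v, hv, hlast, hvj⟩ := hj
      choose u hu using fun l : {l : κ // l < j ∧ l ∉ P} => ih l.1 l.2.1 l.2.2
      refine ⟨(v j)⁻¹ • (v - ∑ l, v l.1 • u l), K.smul_mem _ (K.sub_mem hv
        (K.sum_mem fun l _ => K.smul_mem _ (hu l).1)), ?_, ?_, ?_⟩
      · have : ∀ l, u l j = 0 := fun l => (hu l).2.2.1 j l.2.1
        simp [this, hvj]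
      · intro m hm
        have : ∀ l, u l m = 0 := fun l => (hu l).2.2.1 m (l.2.1.trans hm)
        simp [this, hlast m hm]
      · intro m hm hmj
        rcases lt_or_gt_of_ne hmj with hlt | hgt
        · simp only [Pi.smul_apply, Pi.sub_apply, Finset.sum_apply, smul_eq_mul]
          rw [Finset.sum_eq_single ⟨m, hlt, hm⟩]
          · simp [(hu ⟨m, hlt, hm⟩).2.1]
          · intro l _ hl
            simp [(hu l).2.2.2 m hm fun e => hl (Subtype.ext e.symm)]
          · simp
        · have : ∀ l, u l m = 0 := fun l => (hu l).2.2.1 m (l.2.1.trans hgt)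
          simp [this, hlast m hgt]
  choose u hu using hex
  -- The entries in free columns are chosen so that the kernel vectors given by `exists_ker` are the
  -- basis vectors `u j`.
  let A : Matrix P κ F := Matrix.of fun i j =>
    if hj : j ∈ P then (if i.1 = j then 1 else 0) else - u j hj i.1
  have hA : IsReduced A (Subtype.val : P → κ) :=
    { pivot := fun i => by simp [A]
      pivot_only := fun i i' hne => by simp [A, Subtype.ext_iff.not.1 hne]
      before := fun i j hj => by
        by_cases h : j ∈ P
        · simp [A, h, hj.ne']
        · simp [A, h, (hu j h).2.2.1 i.1 hj] }
  have hun : ∀ j (hj : j ∉ P), A.mulVec (u j hj) = 0 := by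
    intro j hj
    obtain ⟨v, hv, hvj, hv0, hvp, -⟩ := hA.exists_ker (j := j) (by simpa using hj)
    have : u j hj = v := by
      ext l
      by_cases hl : l ∈ P
      · have := hvp ⟨l, hl⟩
        simp only [A, Matrix.of_apply, dif_neg hj, neg_neg] at this
        exact this.symm
      · by_cases hlj : l = j
        · subst hlj
          rw [hvj, (hu l hj).2.1]
        · rw [(hu j hj).2.2.2 l hl hlj, hv0 l (by simpa using hl) hlj]
    rw [this, hv]
  have hspan : ∀ v : κ → F, ∃ w ∈ K, A.mulVec w = 0 ∧ ∀ l, l ∉ P → w l = v l := by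
    intro v
    refine ⟨∑ j : {j : κ // j ∉ P}, v j.1 • u j.1 j.2,
      K.sum_mem fun j _ => K.smul_mem _ (hu j.1 j.2).1, ?_, fun l hl => ?_⟩
    · rw [Matrix.mulVec_sum]
      simp [Matrix.mulVec_smul, hun]
    · rw [Finset.sum_apply, Finset.sum_eq_single ⟨l, hl⟩]
      · simp [(hu l hl).2.1]
      · intro j _ hj
        simp [(hu j.1 j.2).2.2.2 l hl fun e => hj (Subtype.ext e.symm)]
      · simp
  refine ⟨P, A, hA, fun v => ?_⟩
  obtain ⟨w, hwK, hw, hwv⟩ := hspan v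
  constructor
  · intro hv
    rw [hA.ker_ext hv hw fun l hl => (hwv l (by simpa using hl)).symm]
    exact hwK
  · intro hv
    have := hdet (v - w) (K.sub_mem hv hwK) fun l hl => by simp [hwv l hl]
    rw [sub_eq_zero.1 this, hw]

end Reduced

end

end ZXCSS

/-! ### The codespace of a CSS code -/

namespace ZXCSS

noncomputable section

variable {n : ℕ}

lemma bitSign_eq_one {a : ZMod 2} (h : bitSign a = 1) : a = 0 := by
  rcases zmod_two_cases a with rfl | rfl
  · rfl
  · rw [bitSign_one] at h
    norm_num at h

/-- Tensor products of `I` and `Z` gates act by signs. -/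
lemma IsZType.exists_mulVec {M : Op n} (hM : IsZType M) : ∃ z : Fin n → ZMod 2,
    ∀ (ψ : State n) (b : Bits n), M.mulVec ψ b = bitSign (z ⬝ᵥ bits b) * ψ b := by
  classical
  obtain ⟨P, hP, rfl⟩ := hM
  have : ∀ i, ∃ z : ZMod 2, ∀ a b, P i a b = if a = b then bitSign (z * bit a) else 0 := by
    intro i
    rcases hP i with h | h
    · exact ⟨0, fun a b => by simp [h, Matrix.one_apply, bitSign_zero]⟩
    · refine ⟨1, fun a b => ?_⟩
      rw [h]
      fin_cases a <;> fin_cases b <;>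
        simp [pauliZ, bit_zero, bit_one, bitSign_zero, bitSign_one]
  choose z hz using this
  refine ⟨z, fun ψ b => ?_⟩
  have ht : ∀ a, tensor P b a = if b = a then bitSign (z ⬝ᵥ bits b) else 0 := by
    intro a
    simp only [tensor, Matrix.of_apply, hz, Finset.prod_ite_zero, Finset.mem_univ, true_imp_iff,
      funext_iff, dotProduct, bitSign_sum, bits_apply]
  simp [Matrix.mulVec, dotProduct, ht]

/-- Tensor products of `I` and `X` gates act by translations. -/
lemma IsXType.exists_mulVec {M : Op n} (hM : IsXType M) : ∃ x : Fin n → ZMod 2,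
    ∀ (ψ : State n) (b : Bits n), M.mulVec ψ b = ψ (bits.symm (bits b + x)) := by
  classical
  obtain ⟨P, hP, rfl⟩ := hM
  have : ∀ i, ∃ x : ZMod 2, ∀ a b, P i a b = if bit a + x = bit b then 1 else 0 := by
    intro i
    rcases hP i with h | h
    · exact ⟨0, fun a b => by simp [h, Matrix.one_apply]⟩
    · refine ⟨1, fun a b => ?_⟩
      have h2 : (1 + 1 : ZMod 2) = 0 := rfl
      rw [h]
      fin_cases a <;> fin_cases b <;> simp [pauliX, bit_zero, bit_one, h2]
  choose x hx using this
  refine ⟨x, fun ψ b => ?_⟩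
  have ht : ∀ a, tensor P b a = if bits.symm (bits b + x) = a then 1 else 0 := by
    intro a
    simp only [tensor, Matrix.of_apply, hx, Finset.prod_ite_zero, Finset.mem_univ, true_imp_iff,
      Finset.prod_const_one, Equiv.symm_apply_eq, funext_iff, bits_apply, Pi.add_apply]
  simp [Matrix.mulVec, dotProduct, ht]

lemma StabilizerCode.mem_codespace_iff (C : StabilizerCode n) {G : Set (Op n)ˣ}
    (hG : Subgroup.closure G = C.stab) (ψ : State n) :
    ψ ∈ C.codespace ↔ ∀ g ∈ G, (g : Op n).mulVec ψ = ψ := by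
  have h1 : ψ ∈ C.codespace ↔ ∀ g ∈ C.stab, (g : Op n).mulVec ψ = ψ := by
    simp [StabilizerCode.codespace, Submodule.mem_iInf]
  rw [h1, ← hG]
  refine ⟨fun h g hg => h g (Subgroup.subset_closure hg), fun h g hg => ?_⟩
  induction hg using Subgroup.closure_induction with
  | mem g hg => exact h g hg
  | one => simp
  | mul g g' _ _ hg hg' => rw [Units.val_mul, ← Matrix.mulVec_mulVec, hg', hg]
  | inv g _ hg =>
    nth_rewrite 1 [← hg]
    rw [Matrix.mulVec_mulVec, Units.inv_mul, Matrix.one_mulVec]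

/-- The codespace of a CSS code consists of the states that are supported on a subspace `K` and
invariant under the translations by a subspace `L ≤ K`. -/
theorem StabilizerCode.IsCSS.exists_subspaces {C : StabilizerCode n} (hC : C.IsCSS) :
    ∃ K L : Submodule (ZMod 2) (Fin n → ZMod 2), L ≤ K ∧ ∀ ψ : State n, ψ ∈ C.codespace ↔
      (∀ b, ψ b ≠ 0 → bits b ∈ K) ∧ ∀ b b', bits b - bits b' ∈ L → ψ b = ψ b' := by
  obtain ⟨G, hG, htype⟩ := hC
  let SZ : Set (Fin n → ZMod 2) := {z | ∃ g ∈ G, ∀ (ψ : State n) (b : Bits n),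
    (g : Op n).mulVec ψ b = bitSign (z ⬝ᵥ bits b) * ψ b}
  let SX : Set (Fin n → ZMod 2) := {x | ∃ g ∈ G, ∀ (ψ : State n) (b : Bits n),
    (g : Op n).mulVec ψ b = ψ (bits.symm (bits b + x))}
  let K : Submodule (ZMod 2) (Fin n → ZMod 2) :=
    { carrier := {v | ∀ z ∈ SZ, z ⬝ᵥ v = 0}
      zero_mem' := fun z _ => dotProduct_zero z
      add_mem' := fun {v w} hv hw z hz => by rw [dotProduct_add, hv z hz, hw z hz, add_zero]
      smul_mem' := fun c v hv z hz => by rw [dotProduct_smul, hv z hz, smul_zero] }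
  refine ⟨K, Submodule.span _ SX, Submodule.span_le.2 ?_, fun ψ => ?_⟩
  · rintro x ⟨h, hhG, hh⟩ z ⟨g, hgG, hg⟩
    -- Evaluating `g h = h g` on the constant function `1` at the zero label gives `1 = (-1)^(z ⬝ᵥ
    -- x)`.
    have hcomm := C.comm g (hG ▸ Subgroup.subset_closure hgG) h (hG ▸ Subgroup.subset_closure hhG)
    have h1 : ((g * h : (Op n)ˣ) : Op n).mulVec (fun _ => 1) (bits.symm 0) =
        ((h * g : (Op n)ˣ) : Op n).mulVec (fun _ => 1) (bits.symm 0) := by rw [hcomm]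
    rw [Units.val_mul, Units.val_mul, ← Matrix.mulVec_mulVec, ← Matrix.mulVec_mulVec, hg, hh, hh,
      hg] at h1
    simp only [Equiv.apply_symm_apply, dotProduct_zero, bitSign_zero, zero_add, mul_one] at h1
    exact bitSign_eq_one h1.symm
  · rw [C.mem_codespace_iff hG]
    constructor
    · intro hψ
      refine ⟨fun b hb z hz => ?_, fun b b' hbb => ?_⟩
      · obtain ⟨g, hgG, hg⟩ := hz
        have h1 := hg ψ b
        rw [hψ g hgG] at h1
        exact bitSign_eq_one (mul_right_cancel₀ hb (by rw [one_mul]; exact h1.symm))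
      · have key : ∀ x ∈ Submodule.span (ZMod 2) SX, ∀ b, ψ (bits.symm (bits b + x)) = ψ b := by
          intro x hx
          induction hx using Submodule.span_induction with
          | mem x hx =>
            obtain ⟨g, hgG, hg⟩ := hx
            intro b
            rw [← hg ψ b, hψ g hgG]
          | zero => simp
          | add x y _ _ hx hy =>
            intro b
            have := hy (bits.symm (bits b + x))
            rwa [Equiv.apply_symm_apply, hx, add_assoc] at this
          | smul c x _ hx =>
            intro b
            rcases zmod_two_cases c with rfl | rfl
            · simp
            · simpa using hx b
        have := key _ hbb b'
        rwa [add_sub_cancel, Equiv.symm_apply_apply] at this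
    · rintro ⟨h1, h2⟩ g hgG
      ext b
      rcases htype g hgG with hz | hx
      · obtain ⟨z, hz⟩ := hz.exists_mulVec
        rw [hz]
        by_cases hb : ψ b = 0
        · rw [hb, mul_zero]
        · rw [h1 b hb z ⟨g, hgG, hz⟩, bitSign_zero, one_mul]
      · obtain ⟨x, hx⟩ := hx.exists_mulVec
        rw [hx]
        refine h2 _ _ ?_
        rw [Equiv.apply_symm_apply, add_sub_cancel_left]
        exact Submodule.subset_span ⟨g, hgG, hx⟩

end

end ZXCSS

/-! ### The linear map of a KL diagram -/

namespace ZXCSS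

noncomputable section

namespace Diagram

variable {k n : ℕ} {D : Diagram k n}

lemma toLin_apply (hB : D.BipartiteRule) (hP : D.PhaseFreeRule) :
    ∃ c : ℂ, c ≠ 0 ∧ ∀ (φ : State k) (b : Bits n), D.toLin φ b =
      if D.outputMatrix.mulVec (bits b) = 0
      then c * φ (bits.symm (D.fullInputMatrix.mulVec (bits b))) else 0 := by
  obtain ⟨c, hc, h⟩ := matrix_apply hB hP
  refine ⟨c, hc, fun φ b => ?_⟩
  rw [toLin, Matrix.toLin'_apply, Matrix.mulVec, dotProduct]
  simp only [h]
  split_ifs with h0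
  · simp only [true_and, ite_mul, zero_mul, h0]
    simp only [← Equiv.symm_apply_eq (e := bits)]
    simp
  · simp [h0]

lemma fullInputMatrix_apply_of_X (hB : D.BipartiteRule) (i : Fin k) {j : Fin n}
    (hj : D.color (Sum.inr j) = Color.X) : D.fullInputMatrix i j = 0 :=
  adj_eq_zero_of_color hB ((hB.1 i).trans hj.symm)

lemma fullInputMatrix_mulVec_congr (hB : D.BipartiteRule) {v w : Fin n → ZMod 2}
    (h : ∀ l, D.color (Sum.inr l) = Color.Z → v l = w l) :
    D.fullInputMatrix.mulVec v = D.fullInputMatrix.mulVec w := by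
  ext i
  simp only [Matrix.mulVec, dotProduct]
  refine Finset.sum_congr rfl fun l _ => ?_
  rcases color_cases (D.color (Sum.inr l)) with hl | hl
  · rw [h l hl]
  · rw [fullInputMatrix_apply_of_X hB i hl, zero_mul, zero_mul]

lemma RREFRule.isReduced_outputMatrix (h : D.RREFRule) :
    IsReduced D.outputMatrix Subtype.val :=
  h.2.1.isReduced h.2.2

lemma notMem_range_val_iff {l : Fin n} :
    l ∉ Set.range (Subtype.val : {j : Fin n // D.color (Sum.inr j) = Color.X} → Fin n) ↔
      D.color (Sum.inr l) = Color.Z := by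
  rw [Subtype.range_val_subtype, Set.mem_ofPred_eq]
  rcases color_cases (D.color (Sum.inr l)) with hl | hl <;> simp [hl]

/-- An injective diagram has no zero row in its input matrix. -/
lemma IsKL.exists_pivots (h : D.IsKL) (hinj : Function.Injective D.toLin) :
    ∃ p : Fin k → Fin n, IsReduced D.fullInputMatrix p ∧ StrictMono p := by
  obtain ⟨hB, hP, hR⟩ := h
  obtain ⟨c, -, hc⟩ := toLin_apply hB hP
  have hrow : ∀ i, ∃ j, D.inputMatrix i j ≠ 0 := by
    intro i
    by_contra! h0
    have hz : ∀ v, D.fullInputMatrix.mulVec v i = 0 := by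
      intro v
      simp only [Matrix.mulVec, dotProduct]
      refine Finset.sum_eq_zero fun l _ => ?_
      rcases color_cases (D.color (Sum.inr l)) with hl | hl
      · exact mul_eq_zero_of_left (h0 ⟨l, hl⟩) _
      · rw [fullInputMatrix_apply_of_X hB i hl, zero_mul]
    -- With a zero row `i`, no label `b` is mapped to the `i`-th unit vector, so that basis state is
    -- sent to zero.
    have h1 : D.toLin (Pi.single (bits.symm (Pi.single i 1)) 1) = D.toLin 0 := by
      ext b
      rw [hc, map_zero, Pi.zero_apply, Pi.single_eq_of_ne, mul_zero, ite_self]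
      intro he
      have := congrFun (bits.symm.injective he) i
      rw [hz, Pi.single_eq_same] at this
      exact zero_ne_one this
    have h2 := congrFun (hinj h1) (bits.symm (Pi.single i 1))
    simp at h2
  choose p hp using fun i => exists_isLeading (hrow i)
  have hred := hR.1.isReduced hp
  refine ⟨fun i => (p i).1, ⟨hred.pivot, hred.pivot_only, fun i j hj => ?_⟩,
    fun i i' hii => hR.1.strictMono hp hii⟩
  rcases color_cases (D.color (Sum.inr j)) with hl | hl
  · exact hred.before i ⟨j, hl⟩ hj
  · exact fullInputMatrix_apply_of_X hB i hl

/-! ### Uniqueness: recovering the diagram from the code -/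

variable {C : StabilizerCode n}

/-- This recovers `K` from the code: every codeword is supported on the kernel, and the image of the
constant function `1` is nonzero on all of it. -/
lemma Expresses.mem_ker_iff (hB : D.BipartiteRule) (hP : D.PhaseFreeRule) (hC : D.Expresses C)
    (b : Bits n) : D.outputMatrix.mulVec (bits b) = 0 ↔ ∃ ψ ∈ C.codespace, ψ b ≠ 0 := by
  obtain ⟨c, hc0, hc⟩ := toLin_apply hB hP
  rw [← hC.2]
  constructor
  · intro h
    exact ⟨D.toLin fun _ => 1, ⟨_, rfl⟩, by rw [hc, if_pos h]; simpa using hc0⟩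
  · rintro ⟨_, ⟨φ, rfl⟩, hφ⟩
    by_contra h
    exact hφ (by rw [hc, if_neg h])

/-- This recovers the fibres of the input matrix on `K`, the cosets of `L`: the image of the basis
state at the label of `b` separates `b` from every label in another fibre. -/
lemma Expresses.fullInputMatrix_eq_iff (hB : D.BipartiteRule) (hP : D.PhaseFreeRule)
    (hC : D.Expresses C) {b b' : Bits n} (hb : D.outputMatrix.mulVec (bits b) = 0)
    (hb' : D.outputMatrix.mulVec (bits b') = 0) :
    D.fullInputMatrix.mulVec (bits b) = D.fullInputMatrix.mulVec (bits b') ↔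
      ∀ ψ ∈ C.codespace, ψ b = ψ b' := by
  obtain ⟨c, hc0, hc⟩ := toLin_apply hB hP
  rw [← hC.2]
  constructor
  · rintro h _ ⟨φ, rfl⟩
    rw [hc, hc, if_pos hb, if_pos hb', h]
  · intro h
    have := h _ ⟨Pi.single (bits.symm (D.fullInputMatrix.mulVec (bits b))) 1, rfl⟩
    rw [hc, hc, if_pos hb, if_pos hb', Pi.single_eq_same] at this
    by_contra hne
    rw [Pi.single_eq_of_ne] at this
    · simp [hc0] at this
    · exact fun e => hne (bits.symm.injective e).symm

lemma edge_eq_of_adj {D' : Diagram k n} (hP : D.PhaseFreeRule) (hP' : D'.PhaseFreeRule)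
    {u v : Fin k ⊕ Fin n} (h : D.adj u v = D'.adj u v) : D.edge u v = D'.edge u v := by
  have h1 := hP.2.2 u v
  have h2 := hP'.2.2 u v
  unfold adj at h
  cases h3 : D.edge u v <;> cases h4 : D'.edge u v <;> simp_all

/-- The code only sees the input matrix on the kernel of the output matrix. That is enough, since
the input matrix ignores `X` coordinates and any values on the `Z` coordinates extend to that
kernel. -/
lemma fullInputMatrix_ker_iff (h : D.IsKL) (v : Fin n → ZMod 2) :
    D.fullInputMatrix.mulVec v = 0 ↔ ∃ w, D.outputMatrix.mulVec w = 0 ∧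
      D.fullInputMatrix.mulVec w = 0 ∧ ∀ l, D.color (Sum.inr l) = Color.Z → w l = v l := by
  obtain ⟨hB, -, hR⟩ := h
  constructor
  · intro hv
    obtain ⟨w, hw, hwv⟩ := hR.isReduced_outputMatrix.exists_ker_extend v
    have hwv' := fun l hl => hwv l (notMem_range_val_iff.2 hl)
    exact ⟨w, hw, (fullInputMatrix_mulVec_congr hB hwv').trans hv, hwv'⟩
  · rintro ⟨w, -, hw, hwv⟩
    rw [← hw, fullInputMatrix_mulVec_congr hB hwv]

/-- The code determines the KL diagram with a given number of inputs. -/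
theorem eq_of_expresses {D' : Diagram k n} (h : D.IsKL) (h' : D'.IsKL) (hC : D.Expresses C)
    (hC' : D'.Expresses C) : D = D' := by
  have ⟨hB, hP, hR⟩ := h
  have ⟨hB', hP', hR'⟩ := h'
  have hker : ∀ v, D.outputMatrix.mulVec v = 0 ↔ D'.outputMatrix.mulVec v = 0 := by
    intro v
    obtain ⟨b, rfl⟩ := bits.surjective v
    rw [hC.mem_ker_iff hB hP, hC'.mem_ker_iff hB' hP']
  have hcolor : ∀ v, D.color v = D'.color v := by
    rintro (i | j)
    · rw [hB.1, hB'.1]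
    · have h1 : D.color (Sum.inr j) = Color.Z ↔ D'.color (Sum.inr j) = Color.Z := by
        rw [← notMem_range_val_iff, ← notMem_range_val_iff,
          hR.isReduced_outputMatrix.range_eq hR'.isReduced_outputMatrix hker]
      rcases color_cases (D.color (Sum.inr j)) with h2 | h2 <;>
        rcases color_cases (D'.color (Sum.inr j)) with h3 | h3 <;> simp_all
  -- Lying in the kernel means lying in the same fibre as the zero label.
  have hker0 : ∀ w, D.outputMatrix.mulVec w = 0 →
      (D.fullInputMatrix.mulVec w = 0 ↔ D'.fullInputMatrix.mulVec w = 0) := by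
    intro w hw
    obtain ⟨b, rfl⟩ := bits.surjective w
    obtain ⟨z, hz⟩ := (bits (n := n)).surjective 0
    have h1 := hC.fullInputMatrix_eq_iff hB hP hw (b' := z) (by rw [hz, Matrix.mulVec_zero])
    have h2 := hC'.fullInputMatrix_eq_iff hB' hP' ((hker _).1 hw) (b' := z)
      (by rw [hz, Matrix.mulVec_zero])
    rw [hz, Matrix.mulVec_zero] at h1 h2
    rw [h1, h2]
  have hkerI : ∀ v, D.fullInputMatrix.mulVec v = 0 ↔ D'.fullInputMatrix.mulVec v = 0 := by
    intro v
    rw [fullInputMatrix_ker_iff h, fullInputMatrix_ker_iff h']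
    refine exists_congr fun w => ?_
    rw [← hker w]
    refine and_congr_right fun hw => ?_
    rw [hker0 w hw]
    simp only [hcolor]
  obtain ⟨p, hp, hpm⟩ := h.exists_pivots hC.1
  obtain ⟨p', hp', hpm'⟩ := h'.exists_pivots hC'.1
  -- The kernel gives only the set of pivots; the increasing order of the rows matches them one by
  -- one.
  have hpp : p = p' := (hpm.range_inj hpm').1 (hp.range_eq hp' hkerI)
  have hin : ∀ i j, D.adj (Sum.inl i) (Sum.inr j) = D'.adj (Sum.inl i) (Sum.inr j) :=
    fun i j => hp.row_eq hp' hkerI (congrFun hpp i) j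
  have hout : ∀ j l, D.color (Sum.inr j) = Color.X → j ≠ l →
      D.adj (Sum.inr j) (Sum.inr l) = D'.adj (Sum.inr j) (Sum.inr l) := by
    intro j l hj hjl
    have := hR.isReduced_outputMatrix.row_eq hR'.isReduced_outputMatrix hker
      (i := ⟨j, hj⟩) (i' := ⟨j, (hcolor _).symm.trans hj⟩) rfl l
    simpa [outputMatrix, adj, hjl] using this
  have hsymm : ∀ (E : Diagram k n) u v, E.adj u v = E.adj v u := fun E u v => by
    rw [adj, adj, E.edge_symm]
  have hadj : ∀ u v, D.adj u v = D'.adj u v := by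
    rintro (i | j) (i' | l)
    · simp [adj, edge_input]
    · exact hin i l
    · rw [hsymm, hin, hsymm]
    · by_cases hc : D.color (Sum.inr j) = D.color (Sum.inr l)
      · rw [adj_eq_zero_of_color hB hc, adj_eq_zero_of_color hB' (by rw [← hcolor, ← hcolor, hc])]
      · have hjl : j ≠ l := fun e => hc (by rw [e])
        rcases color_cases (D.color (Sum.inr j)) with h2 | h2
        · rcases color_cases (D.color (Sum.inr l)) with h3 | h3
          · exact absurd (h2.trans h3.symm) hc
          · rw [hsymm, hout l j h3 hjl.symm, hsymm]
        · exact hout j l h2 hjl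
  ext1
  · exact funext hcolor
  · exact funext fun v => (hP.1 v).trans (hP'.1 v).symm
  · exact funext fun v => (hP.2.1 v).trans (hP'.2.1 v).symm
  · exact funext fun u => funext fun v => edge_eq_of_adj hP hP' (hadj u v)

/-- The code determines the number of inputs. -/
lemma Expresses.pow_eq_finrank (hC : D.Expresses C) :
    2 ^ k = Module.finrank ℂ C.codespace := by
  rw [← hC.2, LinearMap.finrank_range_of_inj hC.1]
  simp

/-! ### Existence: building a diagram from the code -/

/-- The bipartite phase-free diagram with given `X` outputs, edges from the inputs and edges
between outputs. -/
def ofMatrices (P : Set (Fin n)) [DecidablePred (· ∈ P)] (B : Matrix (Fin k) (Fin n) (ZMod 2))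
    (A : Matrix (Fin n) (Fin n) (ZMod 2)) (hA : ∀ j, A j j = 0) : Diagram k n where
  color := Sum.elim (fun _ => Color.X) fun j => if j ∈ P then Color.X else Color.Z
  phase _ := 0
  localOp _ := 1
  edge
    | Sum.inl _, Sum.inl _ => EdgeKind.none
    | Sum.inl i, Sum.inr j => if B i j = 0 then EdgeKind.none else EdgeKind.plain
    | Sum.inr j, Sum.inl i => if B i j = 0 then EdgeKind.none else EdgeKind.plain
    | Sum.inr j, Sum.inr l => if A j l = 0 ∧ A l j = 0 then EdgeKind.none else EdgeKind.plain
  edge_symm := by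
    rintro (i | j) (i' | l) <;> simp only [and_comm]
  edge_self := by
    rintro (i | j) <;> simp [hA]
  edge_input _ _ := rfl

/-- The diagram of a pair of reduced matrices. -/
theorem exists_of_isReduced {P : Set (Fin n)} {A : Matrix P (Fin n) (ZMod 2)}
    (hA : IsReduced A (Subtype.val : P → Fin n)) {B : Matrix (Fin k) (Fin n) (ZMod 2)}
    {p : Fin k → Fin n} (hB : IsReduced B p) (hp : StrictMono p)
    (hBP : ∀ i, ∀ j ∈ P, B i j = 0) :
    ∃ D : Diagram k n, D.IsKL ∧ (∀ j, D.color (Sum.inr j) = Color.X ↔ j ∈ P) ∧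
      D.fullInputMatrix = B ∧ ∀ v, D.outputMatrix.mulVec v = 0 ↔ A.mulVec v = 0 := by
  classical
  -- Only the free columns of `A` give edges. The pivot columns form an identity block, which the
  -- output matrix restores by marking each `X` node as joined to itself.
  let A' : Matrix (Fin n) (Fin n) (ZMod 2) := Matrix.of fun j l =>
    if h : j ∈ P ∧ l ∉ P then A ⟨j, h.1⟩ l else 0
  have hA' : ∀ j l, ¬ (j ∈ P ∧ l ∉ P) → A' j l = 0 := fun j l h => dif_neg h
  let D : Diagram k n := ofMatrices P B A' fun j => hA' j j fun h => h.2 h.1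
  have hcol : ∀ j, D.color (Sum.inr j) = if j ∈ P then Color.X else Color.Z := fun j => rfl
  have hcolX : ∀ j, D.color (Sum.inr j) = Color.X ↔ j ∈ P := fun j => by
    rw [hcol]; split_ifs <;> simp_all
  have hcolZ : ∀ j, D.color (Sum.inr j) = Color.Z ↔ j ∉ P := fun j => by
    rw [hcol]; split_ifs <;> simp_all
  have hedge : ∀ i j, D.edge (Sum.inl i) (Sum.inr j) =
      if B i j = 0 then EdgeKind.none else EdgeKind.plain := fun _ _ => rfl
  have hedge' : ∀ j l, D.edge (Sum.inr j) (Sum.inr l) =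
      if A' j l = 0 ∧ A' l j = 0 then EdgeKind.none else EdgeKind.plain := fun _ _ => rfl
  have hin : D.fullInputMatrix = B := by
    ext i j
    rcases zmod_two_cases (B i j) with h | h <;> simp [fullInputMatrix, adj, hedge, h]
  have hout : ∀ (j : Fin n) (hj : D.color (Sum.inr j) = Color.X) (l : Fin n),
      D.outputMatrix ⟨j, hj⟩ l = A ⟨j, (hcolX j).1 hj⟩ l := by
    intro j hj l
    have hjP := (hcolX j).1 hj
    by_cases hjl : j = l
    · subst hjl
      simpa [outputMatrix] using (hA.pivot ⟨j, hjP⟩).symm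
    · by_cases hl : l ∈ P
      · rw [hA.pivot_only ⟨l, hl⟩ ⟨j, hjP⟩ (fun e => hjl (congrArg Subtype.val e))]
        simp [outputMatrix, hjl, hedge', hA' j l (fun h => h.2 hl), hA' l j (fun h => h.2 hjP)]
      · have h1 : A' j l = A ⟨j, hjP⟩ l := dif_pos ⟨hjP, hl⟩
        rcases zmod_two_cases (A ⟨j, hjP⟩ l) with h | h <;>
          simp [outputMatrix, hjl, hedge', hA' l j (fun h => hl h.1), h1, h]
  have hbip : D.BipartiteRule := by
    refine ⟨fun _ => rfl, ?_⟩
    have h1 : ∀ i j, D.edge (Sum.inl i) (Sum.inr j) ≠ EdgeKind.none →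
        D.color (Sum.inr j) = Color.Z := by
      intro i j h
      rw [hcolZ]
      intro hj
      exact h (by rw [hedge, if_pos (hBP i j hj)])
    rintro (i | j) (i' | l) h
    · exact absurd rfl h
    · rw [h1 i l h]
      exact fun e => by cases e
    · rw [D.edge_symm] at h
      rw [h1 i' j h]
      exact fun e => by cases e
    · intro e
      refine h ?_
      have hPP : j ∈ P ↔ l ∈ P := by rw [← hcolX, ← hcolX, e]
      rw [hedge', if_pos ⟨hA' j l fun h => h.2 (hPP.1 h.1), hA' l j fun h => h.2 (hPP.2 h.1)⟩]
  have hred : IsReduced D.outputMatrix Subtype.val :=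
    { pivot := fun i => by rw [hout i.1 i.2]; exact hA.pivot ⟨i.1, _⟩
      pivot_only := fun i i' hne => by
        rw [hout i'.1 i'.2]
        exact hA.pivot_only ⟨i.1, (hcolX _).1 i.2⟩ ⟨i'.1, _⟩
          fun e => hne (Subtype.ext (Subtype.mk.inj e))
      before := fun i j hj => by rw [hout i.1 i.2]; exact hA.before ⟨i.1, _⟩ j hj }
  have hpZ : ∀ i, D.color (Sum.inr (p i)) = Color.Z := fun i => by
    rw [hcolZ]
    intro h
    have := hBP i _ h
    rw [hB.pivot] at this
    exact one_ne_zero this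
  have hinE : ∀ i (j : {j : Fin n // D.color (Sum.inr j) = Color.Z}),
      D.inputMatrix i j = B i j.1 := fun i j => by rw [← hin]; rfl
  have hredI : IsReduced D.inputMatrix fun i => ⟨p i, hpZ i⟩ :=
    { pivot := fun i => by rw [hinE]; exact hB.pivot i
      pivot_only := fun i i' hne => by rw [hinE]; exact hB.pivot_only i i' hne
      before := fun i j hj => by rw [hinE]; exact hB.before i j.1 hj }
  refine ⟨D, ⟨hbip, ⟨fun _ => rfl, fun _ => rfl, ?_⟩, hredI.isRREF fun i i' h => hp h,
    hred.isRREF fun i i' h => h, hred.isLeading⟩, hcolX, hin, fun v => ?_⟩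
  · rintro (i | j) (i' | l)
    · exact fun e => by cases e
    · rw [hedge]; split_ifs <;> simp
    · rw [D.edge_symm, hedge]; split_ifs <;> simp
    · rw [hedge']; split_ifs <;> simp
  · rw [funext_iff, funext_iff]
    constructor
    · intro h i
      have := h ⟨i.1, (hcolX _).2 i.2⟩
      simpa only [Matrix.mulVec, dotProduct, hout, Pi.zero_apply] using this
    · intro h i
      have := h ⟨i.1, (hcolX _).1 i.2⟩
      simpa only [Matrix.mulVec, dotProduct, hout i.1 i.2, Pi.zero_apply] using this

/-- Every CSS code is expressed by a KL diagram. -/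
theorem exists_expresses (hC : C.IsCSS) : ∃ (k : ℕ) (D : Diagram k n), D.IsKL ∧ D.Expresses C := by
  classical
  obtain ⟨K, L, hLK, hcode⟩ := hC.exists_subspaces
  obtain ⟨P, A, hA, hAK⟩ := exists_isReduced_ker K
  -- The projection of `L` to the coordinates outside `P`, with the coordinates in `P` left free.
  -- The freedom puts the unit vectors of `P` in `L'`, so a matrix with kernel `L'` vanishes on the
  -- columns in `P`, as the bipartite rule demands.
  let L' : Submodule (ZMod 2) (Fin n → ZMod 2) :=
    { carrier := {v | ∃ w ∈ L, ∀ l, l ∉ P → w l = v l}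
      zero_mem' := ⟨0, L.zero_mem, fun _ _ => rfl⟩
      add_mem' := by
        rintro v v' ⟨w, hw, h⟩ ⟨w', hw', h'⟩
        exact ⟨w + w', L.add_mem hw hw', fun l hl => by simp [h l hl, h' l hl]⟩
      smul_mem' := by
        rintro c v ⟨w, hw, h⟩
        exact ⟨c • w, L.smul_mem c hw, fun l hl => by simp [h l hl]⟩ }
  obtain ⟨Q, B, hB, hBL⟩ := exists_isReduced_ker L'
  let e : Fin (Fintype.card Q) ≃o Q := Fintype.orderIsoFinOfCardEq Q rfl
  have hBe : IsReduced (B.submatrix e id) fun i => (e i).1 :=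
    { pivot := fun i => hB.pivot (e i)
      pivot_only := fun i i' hne => hB.pivot_only (e i) (e i') (e.injective.ne hne)
      before := fun i j hj => hB.before (e i) j hj }
  have hBP : ∀ i, ∀ j ∈ P, B.submatrix e id i j = 0 := by
    intro i j hj
    have h1 : Pi.single j 1 ∈ L' := ⟨0, L.zero_mem, fun l hl => by
      rw [Pi.single_eq_of_ne (fun e => hl (by rwa [e])), Pi.zero_apply]⟩
    have := congrFun ((hBL _).2 h1) (e i)
    rw [Matrix.mulVec_single_one] at this
    exact this
  have hBker : ∀ v, (B.submatrix e id).mulVec v = 0 ↔ v ∈ L' := by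
    intro v
    rw [← hBL, funext_iff, funext_iff, e.surjective.forall]
    rfl
  obtain ⟨D, hD, hcol, hin, hout⟩ := exists_of_isReduced hA hBe (fun i i' h => e.strictMono h) hBP
  have hKD : ∀ v, D.outputMatrix.mulVec v = 0 ↔ v ∈ K := fun v => (hout v).trans (hAK v)
  have hsurj : ∀ a : Bits _, ∃ b : Bits n, D.outputMatrix.mulVec (bits b) = 0 ∧
      D.fullInputMatrix.mulVec (bits b) = bits a := by
    intro a
    -- A solution `w` on all outputs is moved into `K` by changing only its `X` coordinates, which
    -- the input matrix does not see.
    obtain ⟨w, hw⟩ := hBe.mulVec_surjective (bits a)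
    obtain ⟨v, hv, hvw⟩ := hD.2.2.isReduced_outputMatrix.exists_ker_extend w
    refine ⟨bits.symm v, by rwa [Equiv.apply_symm_apply], ?_⟩
    rw [Equiv.apply_symm_apply, ← hw, ← hin]
    exact fullInputMatrix_mulVec_congr hD.1 fun l hl => hvw l (notMem_range_val_iff.2 hl)
  have hL : ∀ v w, v ∈ K → w ∈ K →
      (D.fullInputMatrix.mulVec v = D.fullInputMatrix.mulVec w ↔ v - w ∈ L) := by
    intro v w hv hw
    rw [hin, ← sub_eq_zero, ← Matrix.mulVec_sub, hBker]
    constructor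
    · rintro ⟨u, hu, huv⟩
      -- Both sides lie in `K` and agree outside `P`, and the free coordinates determine a vector of
      -- `K`. Here `L ≤ K` is essential.
      have : u = v - w := hA.ker_ext ((hAK u).2 (hLK hu)) ((hAK _).2 (K.sub_mem hv hw))
        fun l hl => huv l (by simpa using hl)
      exact this ▸ hu
    · exact fun h => ⟨_, h, fun _ _ => rfl⟩
  obtain ⟨c, hc0, hc⟩ := toLin_apply hD.1 hD.2.1
  refine ⟨_, D, hD, fun φ φ' h => ?_, le_antisymm ?_ fun ψ hψ => ?_⟩
  · ext a
    obtain ⟨b, hb, hba⟩ := hsurj a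
    have := congrFun h b
    rw [hc, hc, if_pos hb, if_pos hb, hba, Equiv.symm_apply_apply] at this
    exact mul_left_cancel₀ hc0 this
  · rintro _ ⟨φ, rfl⟩
    rw [hcode]
    refine ⟨fun b hb => ?_, fun b b' hbb => ?_⟩
    · rw [← hKD]
      by_contra h
      exact hb (by rw [hc, if_neg h])
    · rw [hc, hc]
      have hiff : bits b ∈ K ↔ bits b' ∈ K :=
        ⟨fun h => by simpa using K.sub_mem h (hLK hbb), fun h => by simpa using K.add_mem (hLK hbb) h⟩
      by_cases hb : bits b ∈ K
      · rw [if_pos ((hKD _).2 hb), if_pos ((hKD _).2 (hiff.1 hb)),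
          (hL _ _ hb (hiff.1 hb)).2 hbb]
      · rw [if_neg (fun h => hb ((hKD _).1 h)), if_neg (fun h => hb (hiff.2 ((hKD _).1 h)))]
  · rw [hcode] at hψ
    choose s hs hsa using hsurj
    -- A codeword is constant on the fibres of the input matrix in `K`, so its preimage can be read
    -- off along any section `s`.
    refine ⟨fun a => c⁻¹ * ψ (s a), ?_⟩
    ext b
    rw [hc]
    split_ifs with hb
    · rw [mul_inv_cancel_left₀ hc0]
      refine hψ.2 _ _ ((hL _ _ ((hKD _).1 (hs _)) ((hKD _).1 hb)).1 ?_)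
      rw [hsa, Equiv.apply_symm_apply]
    · by_contra h
      exact hb ((hKD _).2 (hψ.1 b (Ne.symm h)))

end Diagram

end

end ZXCSS

theorem theorem3p2 (n : ℕ) (C : ZXCSS.StabilizerCode n) (hC : C.IsCSS) :
    ∃! D : (k : ℕ) × ZXCSS.Diagram k n, D.2.IsKL ∧ D.2.Expresses C := by
  obtain ⟨k, D, hD, hDC⟩ := ZXCSS.Diagram.exists_expresses hC
  refine ⟨⟨k, D⟩, ⟨hD, hDC⟩, ?_⟩
  rintro ⟨k', D'⟩ ⟨hD', hDC'⟩
  obtain rfl : k' = k := Nat.pow_right_injective le_rfl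
    (hDC'.pow_eq_finrank.trans hDC.pow_eq_finrank.symm)
  exact congrArg (Sigma.mk k') (ZXCSS.Diagram.eq_of_expresses hD' hD hDC' hDC)
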